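/- For $1\le p\le\infty$, $N\in\mathbb N=\{1,2,\dots\}$ and a normed space $X$, let $L_p^N(X)$ be the space of functions $f:\{0,\dots,N-1\}\to X$ with norm $\|f\|=\bigl(\frac1N\sum_{i=0}^{N-1}\|f(i)\|_X^p\bigr)^{1/p}$ if $p<\infty$ and $\|f\|=\max_{0\le i<N}\|f(i)\|_X$ if $p=\infty$. Put $L_p^N=L_p^N(\mathbb R)$, let $\mathcal B_\infty^N(X)$ be the closed unit ball of $L_\infty^N(X)$, and let $S_N:\mathcal B_\infty^N(X)\to X$, $S_Nf=\frac1N\sum_{i=0}^{N-1}f(i)$. Let $F$ be a nonempty set of functions from a nonempty set $D$ to a nonempty set $K$, let $G$ be a normed space and $S:F\to G$ a mapping. *Randomized error.* $e_n^{\rm ran}(S,F)=\inf_{A}\sup_{f\in F}\mathbb E\,\|S(f)-A^\omega(f)\|$, where the infimum is over all families $A^\omega(f)=\varphi^\omega(f(t_1^\omega),\dots,f(t_n^\omega))$, $\omega\in\Omega$, with $\Omega$ a finite probability space (in which all subsets are events), $t_i^\omega\in D$, and $\varphi^\omega:K^n\to G$ arbitrary. *Quantum error.* For $m\in\mathbb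 N$ let $H_m=(\mathbb C^2)^{\otimes m}$ with its standard orthonormal basis $|\ell\rangle$, $0\le\ell<2^m$. A quantum query is a tuple $Q=(m,m',m'',Z,\tau,\beta)$ with $m,m',m''\in\mathbb N$, $m'+m''\le m$, $\emptyset\ne Z\subseteq\{0,\dots,2^{m'}-1\}$, $\tau:Z\to D$ and $\beta:K\to\{0,\dots,2^{m''}-1\}$ arbitrary. For $f\in F$ it defines the unitary operator $Q_f$ on $H_m=H_{m'}\otimes H_{m''}\otimes H_{m-m'-m''}$ given on basis states by $Q_f|i\rangle|x\rangle|y\rangle=|i\rangle|x\oplus\beta(f(\tau(i)))\rangle|y\rangle$ if $i\in Z$ and $Q_f|i\rangle|x\rangle|y\rangle=|i\rangle|x\rangle|y\rangle$ if $i\notin Z$, where $\oplus$ is addition modulo $2^{m''}$. A quantum algorithm with $k$ queries is a tuple $A=(Q,(U_j)_{j=0}^k,b,\varphi)$ with $Q$ a quantum query, $U_j$ arbitrary unitary operators on $H_m$, $0\le b<2^m$, and $\varphi:\{0,\dots,2^m-1\}\to G$ arbitrary. On input $f$ it produces the state $U_kQ_fU_{k-1}\cdots U_1Q_fU_0|b\rangle=\sum_\ell\alpha_{\ell,f}|\ell\rangle$,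 and its output $A(f)$ is the random element of $G$ equal to $\varphi(\ell)$ when the measurement gives $\ell$, which happens with probability $|\alpha_{\ell,f}|^2$. Then $$e_n^{\rm q}(S,F)=\inf_A\sup_{f\in F}\inf\bigl\{\varepsilon:\ \mathbb P\{\|S(f)-A(f)\|\le\varepsilon\}\ge 3/4\bigr\},$$ where the first infimum is over all quantum algorithms with at most $n$ queries. **Corollary.** Let $1\le p\le\infty$. Then there is a constant $c>0$ (depending only on $p$) such that for all $n,M,N\in\mathbb N$ and $X=L_p^M$, $$e_n^{\rm q}(S_N,\mathcal B_\infty^N(X))\le 4\,e_n^{\rm ran}(S_N,\mathcal B_\infty^N(X))\le c\begin{cases}n^{-1/2}&\text{if }2\le p<\infty,\\ n^{-1/2}(\log_2(M+1))^{1/2}&\text{if }p=\infty,\\ n^{-1+1/p}&\text{if }1\le p<2.\end{cases}$$ -/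

import Mathlib

open scoped ENNReal NNReal

noncomputable section

namespace VecMean

/-! ### Normalized sequence spaces -/

/-- The space `L_p^N(X)` of all functions `{0, …, N-1} → X`, with the normalized `p`-norm below. -/
def LpSeq (_p : ℝ≥0∞) (N : ℕ) (X : Type*) : Type _ := Fin N → X

namespace LpSeq

variable {p : ℝ≥0∞} {N : ℕ} {X : Type*}

instance [AddCommGroup X] : AddCommGroup (LpSeq p N X) :=
  inferInstanceAs (AddCommGroup (Fin N → X))

instance [AddCommGroup X] [Module ℝ X] : Module ℝ (LpSeq p N X) :=
  inferInstanceAs (Module ℝ (Fin N → X))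

/-- `‖f‖ = ((1/N) ∑ᵢ ‖f i‖^p)^(1/p)` for `p < ∞`, and `‖f‖ = maxᵢ ‖f i‖` for `p = ∞`. -/
instance [NormedAddCommGroup X] : Norm (LpSeq p N X) where
  norm f := if p = ∞ then ⨆ i : Fin N, ‖f i‖
    else ((1 / (N : ℝ)) * ∑ i : Fin N, ‖f i‖ ^ p.toReal) ^ (1 / p.toReal)

theorem norm_def [NormedAddCommGroup X] (f : LpSeq p N X) :
    ‖f‖ = if p = ∞ then ⨆ i : Fin N, ‖f i‖
      else ((1 / (N : ℝ)) * ∑ i : Fin N, ‖f i‖ ^ p.toReal) ^ (1 / p.toReal) := rfl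

/-- The normalized norm is a nonnegative multiple of Mathlib's unnormalized norm on `PiLp`. -/
theorem norm_eq_scale [NormedAddCommGroup X] [hp : Fact (1 ≤ p)] (f : LpSeq p N X) :
    ‖f‖ = (if p = ∞ then 1 else (1 / (N : ℝ)) ^ (1 / p.toReal)) *
      ‖(WithLp.toLp p f : PiLp p (fun _ : Fin N => X))‖ := by
  rw [norm_def]
  by_cases h : p = ∞
  · subst h
    simp [PiLp.norm_eq_ciSup]
  · have h0 : 0 < p.toReal :=
      ENNReal.toReal_pos (zero_lt_one.trans_le hp.out).ne' h
    rw [if_neg h, if_neg h, PiLp.norm_eq_sum h0,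
      Real.mul_rpow (by positivity) (Finset.sum_nonneg fun i _ => by positivity)]

theorem core [NormedAddCommGroup X] [NormedSpace ℝ X] [hp : Fact (1 ≤ p)] :
    NormedSpace.Core ℝ (LpSeq p N X) where
  norm_nonneg f := by
    rw [norm_eq_scale]
    split_ifs <;> positivity
  norm_smul c f := by
    have h : (WithLp.toLp p (c • f : LpSeq p N X) : PiLp p (fun _ : Fin N => X))
        = c • (WithLp.toLp p f : PiLp p (fun _ : Fin N => X)) := rfl
    rw [norm_eq_scale, norm_eq_scale, h, norm_smul]
    ring
  norm_triangle f g := by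
    have h : (WithLp.toLp p (f + g : LpSeq p N X) : PiLp p (fun _ : Fin N => X))
        = (WithLp.toLp p f : PiLp p (fun _ : Fin N => X))
          + (WithLp.toLp p g : PiLp p (fun _ : Fin N => X)) := rfl
    rw [norm_eq_scale, norm_eq_scale, norm_eq_scale, h, ← mul_add]
    refine mul_le_mul_of_nonneg_left (norm_add_le _ _) ?_
    split_ifs <;> positivity
  norm_eq_zero_iff f := by
    rw [norm_eq_scale]
    rcases Nat.eq_zero_or_pos N with hN | hN
    · subst hN
      have hf : f = 0 := funext fun i => i.elim0
      have h : (WithLp.toLp p (0 : LpSeq p 0 X) : PiLp p (fun _ : Fin 0 => X)) = 0 := rfl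
      simp [hf, h]
    · have hs : (if p = ∞ then (1 : ℝ) else (1 / (N : ℝ)) ^ (1 / p.toReal)) ≠ 0 := by
        split_ifs <;> positivity
      rw [mul_eq_zero, or_iff_right hs, norm_eq_zero]
      exact ⟨fun h => congrArg WithLp.ofLp h, fun h => by rw [h]; rfl⟩

instance [NormedAddCommGroup X] [NormedSpace ℝ X] [Fact (1 ≤ p)] :
    NormedAddCommGroup (LpSeq p N X) :=
  NormedAddCommGroup.ofCore (core (p := p) (N := N) (X := X))

instance [NormedAddCommGroup X] [NormedSpace ℝ X] [Fact (1 ≤ p)] :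
    NormedSpace ℝ (LpSeq p N X) :=
  NormedSpace.ofCore (core (p := p) (N := N) (X := X))

end LpSeq

/-- The unit ball of `L_p^N(X)`, as a set of functions `{0, …, N-1} → X`. -/
def unitBall (p : ℝ≥0∞) (N : ℕ) (X : Type*) [NormedAddCommGroup X] : Set (Fin N → X) :=
  {f | ‖(show LpSeq p N X from f)‖ ≤ 1}

/-- The mean `S_N f = (1/N) ∑ᵢ f i` on the unit ball of `L_∞^N(X)`. -/
def meanMap (N : ℕ) (X : Type*) [NormedAddCommGroup X] [NormedSpace ℝ X] :
    unitBall ∞ N X → X :=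
  fun f => (1 / (N : ℝ)) • ∑ i : Fin N, f.1 i

/-! ### The classical randomized setting -/

/-- A (nonadaptive) randomized algorithm using `n` function values, over a finite probability
space `Ω` in which every set is an event. -/
structure RandAlgorithm (n : ℕ) (D K G : Type*) where
  Ω : Type
  [fintypeΩ : Fintype Ω]
  /-- the probability measure on `Ω` -/
  P : PMF Ω
  /-- the sample points `t_i^ω` -/
  t : Ω → Fin n → D
  /-- the mappings `φ^ω` -/
  φ : Ω → (Fin n → K) → G

attribute [instance] RandAlgorithm.fintypeΩ

namespace RandAlgorithm

variable {n : ℕ} {D K G : Type*}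

/-- The output `A_n^ω(f) = φ^ω(f(t_1^ω), …, f(t_n^ω))`. -/
def output (A : RandAlgorithm n D K G) (f : D → K) (ω : A.Ω) : G :=
  A.φ ω fun i => f (A.t ω i)

/-- The expected error `𝔼 ‖g - A_n^ω(f)‖`. -/
def expError [NormedAddCommGroup G] (A : RandAlgorithm n D K G) (f : D → K) (g : G) : ℝ≥0∞ :=
  ∑ ω : A.Ω, A.P ω * ENNReal.ofReal ‖g - A.output f ω‖

end RandAlgorithm

/-- The `n`-th minimal randomized error `e_n^ran(S, F)`. -/
def eRan (n : ℕ) {D K G : Type*} [NormedAddCommGroup G] {F : Set (D → K)} (S : F → G) : ℝ≥0∞ :=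
  ⨅ A : RandAlgorithm n D K G, ⨆ f : F, A.expError f (S f)

/-! ### The quantum setting -/

/-- The state space `H_m` of `m` qubits; `|ℓ⟩`, `0 ≤ ℓ < 2^m`, is its standard orthonormal basis. -/
abbrev Qubits (m : ℕ) : Type := EuclideanSpace ℂ (Fin (2 ^ m))

/-- A quantum query `Q = (m, m', m'', Z, τ, β)` for `K`-valued functions on `D`. -/
structure QuantumQuery (D K : Type*) where
  m : ℕ
  m' : ℕ
  m'' : ℕ
  m_pos : 0 < m
  m'_pos : 0 < m'
  m''_pos : 0 < m''
  le_m : m' + m'' ≤ m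
  Z : Set (Fin (2 ^ m'))
  Z_nonempty : Z.Nonempty
  τ : Z → D
  β : K → Fin (2 ^ m'')

namespace QuantumQuery

variable {D K : Type*} (Q : QuantumQuery D K)

theorem card_split :
    2 ^ Q.m' * (2 ^ Q.m'' * 2 ^ (Q.m - Q.m' - Q.m'')) = 2 ^ Q.m := by
  rw [← pow_add, ← pow_add]
  congr 1
  have := Q.le_m
  omega

/-- The identification of `(i, x, y)` with `ℓ` in `|i⟩|x⟩|y⟩ = |ℓ⟩`, coming from
`H_m = H_{m'} ⊗ H_{m''} ⊗ H_{m-m'-m''}`: the binary digits of `i` come first, then those of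
`x`, then those of `y`. -/
def split :
    Fin (2 ^ Q.m') × Fin (2 ^ Q.m'') × Fin (2 ^ (Q.m - Q.m' - Q.m'')) ≃ Fin (2 ^ Q.m) :=
  ((Equiv.refl _).prodCongr finProdFinEquiv).trans
    (finProdFinEquiv.trans (finCongr Q.card_split))

theorem split_val (i : Fin (2 ^ Q.m')) (x : Fin (2 ^ Q.m''))
    (y : Fin (2 ^ (Q.m - Q.m' - Q.m''))) :
    (Q.split (i, x, y) : ℕ) =
      i * 2 ^ (Q.m - Q.m') + x * 2 ^ (Q.m - Q.m' - Q.m'') + y := by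
  have h : 2 ^ (Q.m - Q.m') = 2 ^ Q.m'' * 2 ^ (Q.m - Q.m' - Q.m'') := by
    rw [← pow_add]
    congr 1
    have := Q.le_m
    omega
  simp [split, finProdFinEquiv, h]
  ring

open Classical in
/-- What the query adds to the second register: `β(f(τ(i)))` if `i ∈ Z`, and `0` otherwise. -/
def shift (f : D → K) (i : Fin (2 ^ Q.m')) : Fin (2 ^ Q.m'') :=
  if h : i ∈ Q.Z then Q.β (f (Q.τ ⟨i, h⟩)) else 0

/-- `(i, x, y) ↦ (i, x ⊕ β(f(τ(i))), y)` if `i ∈ Z`, and `(i, x, y) ↦ (i, x, y)` otherwise;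
addition in `Fin (2 ^ m'')` is addition modulo `2 ^ m''`. -/
def registerPerm (f : D → K) :
    Equiv.Perm (Fin (2 ^ Q.m') × Fin (2 ^ Q.m'') × Fin (2 ^ (Q.m - Q.m' - Q.m''))) where
  toFun w := (w.1, w.2.1 + Q.shift f w.1, w.2.2)
  invFun w := (w.1, w.2.1 - Q.shift f w.1, w.2.2)
  left_inv w := by simp
  right_inv w := by simp

/-- The induced permutation of the labels `ℓ` of the basis states of `H_m`. -/
def basisPerm (f : D → K) : Equiv.Perm (Fin (2 ^ Q.m)) :=
  (Q.split.symm.trans (Q.registerPerm f)).trans Q.split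

/-- The unitary operator `Q_f` on `H_m`: it permutes the basis states by `basisPerm`. -/
def unitaryOp (f : D → K) : Qubits Q.m ≃ₗᵢ[ℂ] Qubits Q.m :=
  LinearIsometryEquiv.piLpCongrLeft 2 ℂ ℂ (Q.basisPerm f)

/-- `Q_f |i⟩|x⟩|y⟩ = |i⟩|x ⊕ β(f(τ(i)))⟩|y⟩` if `i ∈ Z`, and `|i⟩|x⟩|y⟩` otherwise. -/
theorem unitaryOp_basis (f : D → K) (i : Fin (2 ^ Q.m')) (x : Fin (2 ^ Q.m''))
    (y : Fin (2 ^ (Q.m - Q.m' - Q.m''))) :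
    Q.unitaryOp f (EuclideanSpace.single (Q.split (i, x, y)) 1) =
      EuclideanSpace.single (Q.split (i, x + Q.shift f i, y)) 1 := by
  have h : Q.basisPerm f (Q.split (i, x, y)) = Q.split (i, x + Q.shift f i, y) := by
    simp [basisPerm, registerPerm]
  rw [← h]
  exact LinearIsometryEquiv.piLpCongrLeft_single _ _ _

end QuantumQuery

/-- A quantum algorithm `A = (Q, (U_j)_{j=0}^n, b, φ)` with `n` quantum queries (and one
measurement) for `K`-valued functions on `D`, with outputs in `G`. -/
structure QuantumAlgorithm (n : ℕ) (D K G : Type*) where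
  Q : QuantumQuery D K
  U : Fin (n + 1) → (Qubits Q.m ≃ₗᵢ[ℂ] Qubits Q.m)
  b : Fin (2 ^ Q.m)
  φ : Fin (2 ^ Q.m) → G

namespace QuantumAlgorithm

variable {n : ℕ} {D K G : Type*} (A : QuantumAlgorithm n D K G)

/-- The state `U_n Q_f U_{n-1} ⋯ U_1 Q_f U_0 |b⟩` before the measurement. -/
def finalState (f : D → K) : Qubits A.Q.m :=
  Fin.induction (motive := fun _ => Qubits A.Q.m)
    (A.U 0 (EuclideanSpace.single A.b 1))
    (fun j ψ => A.U j.succ (A.Q.unitaryOp f ψ))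
    (Fin.last n)

/-- The probability that the measurement of the final state gives `ℓ`. -/
def outcomeProb (f : D → K) (ℓ : Fin (2 ^ A.Q.m)) : ℝ := ‖A.finalState f ℓ‖ ^ 2

open Classical in
/-- The probability `ℙ{‖g - A(f, ω)‖ ≤ ε}`, where `A(f, ω) = φ(ℓ)` for the measured `ℓ`. -/
def successProb [NormedAddCommGroup G] (f : D → K) (g : G) (ε : ℝ≥0) : ℝ :=
  ∑ ℓ with ‖g - A.φ ℓ‖ ≤ ε, A.outcomeProb f ℓ

/-- `inf {ε : ℙ{‖g - A(f, ω)‖ ≤ ε} ≥ 3/4}`. -/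
def probError [NormedAddCommGroup G] (f : D → K) (g : G) : ℝ≥0∞ :=
  ⨅ (ε : ℝ≥0) (_ : 3 / 4 ≤ A.successProb f g ε), (ε : ℝ≥0∞)

end QuantumAlgorithm

/-- The `n`-th minimal quantum error `e_n^q(S, F)`: the infimum runs over all quantum algorithms
using at most `n` queries. -/
def eQuant (n : ℕ) {D K G : Type*} [NormedAddCommGroup G] {F : Set (D → K)} (S : F → G) : ℝ≥0∞ :=
  ⨅ (k : ℕ) (_ : k ≤ n) (A : QuantumAlgorithm k D K G), ⨆ f : F, A.probError f (S f)

end VecMean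

end

/-!
A quantum algorithm can simulate a nonadaptive randomized one with the same number of queries. The
first unitary prepares the superposition `∑_ω √(P ω) |ω⟩`, and each later one is a permutation of
basis states that moves the answer just obtained to a storage slot and selects the next sample
point. Each random element `ω` keeps its own basis state, so the final measurement returns `ω`
with probability `P ω`, together with the sampled values, and classical postprocessing finishes the
simulation (`exists_quantumAlgorithm_simulating`). A query writes only finitely many bits, while
the postprocessing `φ^ω` may be discontinuous. The inputs are therefore rounded to finitely many
values inside the unit ball, which is compact; the simulated algorithm sees an exact, admissible
input close to the given one. Markov's inequality at level `1/4` produces the factor `4`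
(`eQuant_le_four_mul_eRan`).

The randomized error is bounded by the Monte Carlo method with `n` independent uniform points
(`eRan_meanMap_le`), so that the mean norm of a sum of `n` independent centered vectors `Y` of norm
at most `2` is to be estimated. This is done with a potential `Φ` for which
`Φ (s + Y) ≤ A Φ s + L_s Y + B` with `L_s` linear: the linear term has mean zero, and the mean of
`Φ` after `n` steps is at most `A ^ n (Φ 0 + n B)` (`expect_potential_le`).

* For `p < ∞`, take `Φ s = ‖s‖ ^ p`. An elementary expansion of `|s + y| ^ p` gives
  `A = 1 + 1 / n` and `B` of order `n ^ max (p / 2 - 1) 0`, hence a mean norm of order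
  `n ^ max (1 / 2) (1 / p)` (`expect_norm_sum_le`).
* For `p = ∞`, take `Φ s = ∑ k, (exp (θ s k) + exp (-θ s k))`. The inequality
  `exp u ≤ u + exp (u ^ 2)` gives `A = exp (4 θ ^ 2)` and `B = 0`, and optimizing `θ` leads to
  `√(n log M)` (`expect_norm_sum_top_le`).
-/

open scoped ENNReal NNReal

noncomputable section

namespace VecMean

/-! ### Quantum simulation of randomized algorithms -/

/-- Every unit vector can be prepared from a given basis state by a unitary operator. -/
theorem exists_unitary_single_eq {ι : Type*} [Fintype ι] [DecidableEq ι] (i : ι)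
    (v : EuclideanSpace ℂ ι) (hv : ‖v‖ = 1) :
    ∃ U : EuclideanSpace ℂ ι ≃ₗᵢ[ℂ] EuclideanSpace ℂ ι, U (EuclideanSpace.single i 1) = v := by
  have ho : Orthonormal ℂ (({i} : Set ι).domRestrict fun _ => v) :=
    ⟨fun _ => hv, fun a b hab => (hab (Subsingleton.elim a b)).elim⟩
  obtain ⟨b, hb⟩ := ho.exists_orthonormalBasis_extension_of_card_eq (by simp)
  refine ⟨b.repr.symm, ?_⟩
  rw [b.repr_symm_single]
  exact hb i rfl

/-- The superposition `∑_ω √(P ω) |e ω⟩` of distinct basis states. -/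
def superpose {Ω ι : Type*} [Fintype Ω] [Fintype ι] [DecidableEq ι] (P : PMF Ω) (e : Ω → ι) :
    EuclideanSpace ℂ ι :=
  ∑ ω, (√(P ω).toReal : ℂ) • EuclideanSpace.single (e ω) 1

section superpose

variable {Ω ι κ : Type*} [Fintype Ω] [Fintype ι] [DecidableEq ι] [Fintype κ] [DecidableEq κ]

theorem superpose_apply (P : PMF Ω) {e : Ω → ι} (he : e.Injective) (ω : Ω) :
    superpose P e (e ω) = (√(P ω).toReal : ℂ) := by
  classical
  simp [superpose, Pi.single_apply, he.eq_iff]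

theorem superpose_apply_of_notMem (P : PMF Ω) {e : Ω → ι} {i : ι} (hi : i ∉ Set.range e) :
    superpose P e i = 0 := by
  have h : ∀ ω, i ≠ e ω := fun ω h => hi ⟨ω, h.symm⟩
  simp [superpose, h]

theorem sum_toReal_eq_one (P : PMF Ω) : ∑ ω, (P ω).toReal = 1 := by
  rw [← ENNReal.toReal_sum fun ω _ => P.apply_ne_top ω, ← tsum_fintype (L := .unconditional _),
    P.tsum_coe, ENNReal.toReal_one]

theorem norm_superpose (P : PMF Ω) {e : Ω → ι} (he : e.Injective) : ‖superpose P e‖ = 1 := by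
  rw [EuclideanSpace.norm_eq, Real.sqrt_eq_one, ← sum_toReal_eq_one P,
    ← Finset.sum_subset (Finset.subset_univ (Finset.univ.image e)),
    Finset.sum_image he.injOn]
  · refine Finset.sum_congr rfl fun ω _ => ?_
    rw [superpose_apply P he]
    simp
  · intro i _ hi
    rw [superpose_apply_of_notMem P (by simpa using hi)]
    simp

/-- Permuting the basis states permutes the terms of a superposition. -/
theorem piLpCongrLeft_superpose (P : PMF Ω) (e : Ω → ι) (σ : ι ≃ κ) :
    LinearIsometryEquiv.piLpCongrLeft 2 ℂ ℂ σ (superpose P e) = superpose P (σ ∘ e) := by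
  simp only [superpose, map_sum, map_smul, Function.comp_apply]
  exact Finset.sum_congr rfl fun ω _ =>
    congrArg _ (LinearIsometryEquiv.piLpCongrLeft_single σ (e ω) 1)

end superpose

namespace QuantumQuery

variable {D K : Type*} (Q : QuantumQuery D K) {I Y : Type*}

/-- A relabelling of the basis states of `H_m`, given by labellings of its outer registers. -/
def layout (eI : I ≃ Fin (2 ^ Q.m')) (eY : Y ≃ Fin (2 ^ (Q.m - Q.m' - Q.m''))) :
    I × Fin (2 ^ Q.m'') × Y ≃ Fin (2 ^ Q.m) :=
  (eI.prodCongr ((Equiv.refl _).prodCongr eY)).trans Q.split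

theorem basisPerm_layout (eI : I ≃ Fin (2 ^ Q.m')) (eY : Y ≃ Fin (2 ^ (Q.m - Q.m' - Q.m'')))
    (f : D → K) (i : I) (x : Fin (2 ^ Q.m'')) (y : Y) :
    Q.basisPerm f (Q.layout eI eY (i, x, y)) = Q.layout eI eY (i, x + Q.shift f (eI i), y) := by
  simp [basisPerm, registerPerm, layout]

end QuantumQuery

/-- If the initial unitary prepares the superposition of the states `e 0 ω` and, for each `j`, a
query followed by the next unitary moves `e j ω` to `e (j + 1) ω`, then the final state is the
superposition of the last states. -/
theorem QuantumAlgorithm.finalState_eq_superpose {n : ℕ} {D K G Ω : Type*} [Fintype Ω]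
    (A : QuantumAlgorithm n D K G) (P : PMF Ω) (f : D → K)
    (e : Fin (n + 1) → Ω → Fin (2 ^ A.Q.m)) (σ : Fin n → Equiv.Perm (Fin (2 ^ A.Q.m)))
    (h0 : A.U 0 (EuclideanSpace.single A.b 1) = superpose P (e 0))
    (hU : ∀ j : Fin n, A.U j.succ = LinearIsometryEquiv.piLpCongrLeft 2 ℂ ℂ (σ j))
    (hσ : ∀ j ω, σ j (A.Q.basisPerm f (e j.castSucc ω)) = e j.succ ω) :
    A.finalState f = superpose P (e (Fin.last n)) := by
  unfold finalState
  generalize Fin.last n = k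
  induction k using Fin.induction with
  | zero => simpa using h0
  | succ j ih =>
    rw [Fin.induction_succ, ih, hU, QuantumQuery.unitaryOp, piLpCongrLeft_superpose,
      piLpCongrLeft_superpose]
    congr 1
    exact funext fun ω => hσ j ω

/-- The permutation of basis states applied after the `j`-th query: it advances the counter from
`c` to `c'` and exchanges the query register with the `j`-th storage slot. -/
def storePerm {J W X : Type*} [DecidableEq J] {n : ℕ} (c c' : J) (j : Fin n) :
    Equiv.Perm ((J × W) × X × (Fin n → X)) where
  toFun s := ((Equiv.swap c c' s.1.1, s.1.2), s.2.2 j, Function.update s.2.2 j s.2.1)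
  invFun s := ((Equiv.swap c c' s.1.1, s.1.2), s.2.2 j, Function.update s.2.2 j s.2.1)
  left_inv s := by simp
  right_inv s := by simp

/-- The contents of the storage slots after `k` queries with answers `z`. -/
def stored {n d : ℕ} (z : Fin n → Fin (2 ^ d)) (k : Fin (n + 1)) : Fin n → Fin (2 ^ d) :=
  fun i => if i.castSucc < k then z i else 0

theorem stored_zero {n d : ℕ} (z : Fin n → Fin (2 ^ d)) : stored z 0 = 0 := by
  ext; simp [stored]

theorem stored_last {n d : ℕ} (z : Fin n → Fin (2 ^ d)) : stored z (Fin.last n) = z := by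
  ext i; simp [stored, Fin.castSucc_lt_last]

theorem stored_castSucc_self {n d : ℕ} (z : Fin n → Fin (2 ^ d)) (j : Fin n) :
    stored z j.castSucc j = 0 := by
  simp [stored]

theorem update_stored {n d : ℕ} (z : Fin n → Fin (2 ^ d)) (j : Fin n) :
    Function.update (stored z j.castSucc) j (z j) = stored z j.succ := by
  ext i
  rcases eq_or_ne i j with rfl | h
  · simp [stored]
  · rw [Function.update_of_ne h]
    have : i < j ↔ i ≤ j := ⟨le_of_lt, fun h' => lt_of_le_of_ne h' h⟩
    simp [stored, this]

/-- A function with finite range factors through codes of finitely many bits. -/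
theorem exists_bit_coding {K : Type*} [Nonempty K] {r : K → K} (hr : (Set.range r).Finite) :
    ∃ d : ℕ, 0 < d ∧ ∃ (β : K → Fin (2 ^ d)) (dec : Fin (2 ^ d) → K), ∀ x, dec (β x) = r x := by
  have := hr.fintype
  obtain ⟨e⟩ : Nonempty (Set.range r ↪ Fin (2 ^ (Fintype.card (Set.range r) + 1))) := by
    refine Function.Embedding.nonempty_of_card_le ?_
    rw [Fintype.card_fin]
    exact (Nat.le_succ _).trans Nat.lt_two_pow_self.le
  refine ⟨_, Nat.succ_pos _, fun x => e ⟨r x, x, rfl⟩,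
    Function.extend e Subtype.val fun _ => Classical.arbitrary K, fun x => ?_⟩
  rw [e.injective.extend_apply]

/-- A randomized algorithm run on the input `r ∘ f`, where `r` has finite range, can be simulated
by a quantum algorithm with the same number of queries on the input `f`. -/
theorem exists_quantumAlgorithm_simulating {n : ℕ} {D K G : Type*} [Nonempty D] [Nonempty K]
    [NormedAddCommGroup G] (R : RandAlgorithm n D K G) {r : K → K} (hr : (Set.range r).Finite) :
    ∃ A : QuantumAlgorithm n D K G, ∀ (f : D → K) (g : G) (ε : ℝ≥0),
      (∑ ω with ‖g - R.output (r ∘ f) ω‖ ≤ ε, (R.P ω).toReal) ≤ A.successProb f g ε := by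
  classical
  obtain ⟨d, hd, β, dec, hdec⟩ := exists_bit_coding hr
  have : Nonempty R.Ω := R.P.support_nonempty.to_type
  obtain ⟨w, hw, ⟨e⟩⟩ : ∃ w, 0 < w ∧ Nonempty (R.Ω ↪ Fin (2 ^ w)) := by
    refine ⟨Fintype.card R.Ω + 1, Nat.succ_pos _, Function.Embedding.nonempty_of_card_le ?_⟩
    rw [Fintype.card_fin]
    exact (Nat.le_succ _).trans Nat.lt_two_pow_self.le
  let c : Fin (n + 1) → Fin (2 ^ n) := Fin.castLE Nat.lt_two_pow_self
  have hc : c.Injective := Fin.castLE_injective _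
  obtain ⟨tt, htt⟩ : ∃ tt : Fin (2 ^ n) × Fin (2 ^ w) → D,
      ∀ (j : Fin n) ω, tt (c j.castSucc, e ω) = R.t ω j := by
    have hinj : (fun q : Fin n × R.Ω => (c q.1.castSucc, e q.2)).Injective := by
      rintro ⟨j, ω⟩ ⟨j', ω'⟩ h
      simp only [Prod.mk.injEq] at h
      rw [Fin.castSucc_injective n (hc h.1), e.injective h.2]
    exact ⟨Function.extend _ (fun q : Fin n × R.Ω => R.t q.2 q.1) fun _ => Classical.arbitrary D,
      fun j ω => hinj.extend_apply (fun q : Fin n × R.Ω => R.t q.2 q.1) _ (j, ω)⟩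
  let eI : Fin (2 ^ n) × Fin (2 ^ w) ≃ Fin (2 ^ (n + w)) :=
    Fintype.equivOfCardEq (by simp [pow_add])
  -- The first register holds the counter and `ω`; the last one holds `n` storage slots.
  let Q : QuantumQuery D K :=
    { m := n + w + d + d * n
      m' := n + w
      m'' := d
      m_pos := by omega
      m'_pos := by omega
      m''_pos := hd
      le_m := by omega
      Z := Set.univ
      Z_nonempty := Set.univ_nonempty
      τ := fun i => tt (eI.symm i)
      β := β }
  let eY : (Fin n → Fin (2 ^ d)) ≃ Fin (2 ^ (Q.m - Q.m' - Q.m'')) :=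
    Fintype.equivOfCardEq (by
      have : n + w + d + d * n - (n + w) - d = d * n := by omega
      simp [Q, this, pow_mul])
  let lay : (Fin (2 ^ n) × Fin (2 ^ w)) × Fin (2 ^ d) × (Fin n → Fin (2 ^ d)) ≃ Fin (2 ^ Q.m) :=
    Q.layout eI eY
  let st (z : R.Ω → Fin n → Fin (2 ^ d)) (k : Fin (n + 1)) (ω : R.Ω) : Fin (2 ^ Q.m) :=
    lay ((c k, e ω), 0, stored (z ω) k)
  have hst : ∀ z k, (st z k).Injective := fun z k ω ω' h => by
    have := lay.injective h
    simp only [Prod.mk.injEq] at this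
    exact e.injective this.1.2
  have hlay : ∀ f i x y, Q.basisPerm f (lay (i, x, y)) = lay (i, x + β (f (tt i)), y) := by
    intro f i x y
    have hs : Q.shift f (eI i) = β (f (tt i)) := by simp [QuantumQuery.shift, Q]
    have h := Q.basisPerm_layout eI eY f i x y
    rw [hs] at h
    exact h
  obtain ⟨U₀, hU₀⟩ := exists_unitary_single_eq (0 : Fin (2 ^ Q.m))
    (superpose R.P (st 0 0)) (norm_superpose _ (hst _ _))
  let σ (j : Fin n) : Equiv.Perm (Fin (2 ^ Q.m)) :=
    (lay.symm.trans (storePerm (c j.castSucc) (c j.succ) j)).trans lay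
  let A : QuantumAlgorithm n D K G :=
    { Q := Q
      U := Fin.cons U₀ fun j => LinearIsometryEquiv.piLpCongrLeft 2 ℂ ℂ (σ j)
      b := 0
      φ := fun ℓ => R.φ (Function.invFun e (lay.symm ℓ).1.2) fun i => dec ((lay.symm ℓ).2.2 i) }
  refine ⟨A, fun f g ε => ?_⟩
  let z (ω : R.Ω) (i : Fin n) : Fin (2 ^ d) := β (f (R.t ω i))
  have hfin : A.finalState f = superpose R.P (st z (Fin.last n)) := by
    refine A.finalState_eq_superpose R.P f (st z) σ ?_ (fun j => rfl) fun j ω => ?_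
    · have : st z 0 = st 0 0 := by funext ω; simp only [st, stored_zero]
      rw [this]
      exact hU₀
    · have h := hlay f (c j.castSucc, e ω) 0 (stored (z ω) j.castSucc)
      rw [htt, zero_add] at h
      calc σ j (Q.basisPerm f (st z j.castSucc ω))
          = σ j (lay ((c j.castSucc, e ω), z ω j, stored (z ω) j.castSucc)) := congrArg _ h
        _ = st z j.succ ω := by
          simp [σ, storePerm, st, stored_castSucc_self, update_stored]
  have hφ : ∀ ω, A.φ (st z (Fin.last n) ω) = R.output (r ∘ f) ω := by
    intro ω
    simp [A, st, stored_last, z, hdec, RandAlgorithm.output,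
      Function.leftInverse_invFun e.injective ω]
  have hprob : ∀ ω, A.outcomeProb f (st z (Fin.last n) ω) = (R.P ω).toReal := by
    intro ω
    rw [QuantumAlgorithm.outcomeProb, hfin]
    have := superpose_apply R.P (hst z (Fin.last n)) ω
    erw [this]
    simp
  unfold QuantumAlgorithm.successProb
  calc (∑ ω with ‖g - R.output (r ∘ f) ω‖ ≤ ε, (R.P ω).toReal)
      = ∑ ω with ‖g - R.output (r ∘ f) ω‖ ≤ ε, A.outcomeProb f (st z (Fin.last n) ω) :=
        Finset.sum_congr rfl fun ω _ => (hprob ω).symm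
    _ = ∑ ℓ ∈ (Finset.univ.filter fun ω => ‖g - R.output (r ∘ f) ω‖ ≤ ε).image
          (st z (Fin.last n)), A.outcomeProb f ℓ :=
        (Finset.sum_image (hst z _).injOn).symm
    _ ≤ _ := by
        refine Finset.sum_le_sum_of_subset_of_nonneg ?_ fun ℓ _ _ => sq_nonneg _
        intro ℓ hℓ
        obtain ⟨ω, hω, rfl⟩ := Finset.mem_image.1 hℓ
        simp only [Finset.mem_filter, Finset.mem_univ, true_and] at hω ⊢
        rwa [hφ]

/-- Markov's inequality for the error of a randomized algorithm. -/
theorem RandAlgorithm.three_quarters_le_prob {n : ℕ} {D K G : Type*} [NormedAddCommGroup G]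
    (R : RandAlgorithm n D K G) (f : D → K) (g : G) (δ : ℝ≥0) (h : R.expError f g ≤ δ) :
    3 / 4 ≤ ∑ ω with ‖g - R.output f ω‖ ≤ 4 * δ, (R.P ω).toReal := by
  have h1 : ∑ ω, (R.P ω).toReal * ‖g - R.output f ω‖ ≤ δ := by
    have := ENNReal.toReal_mono ENNReal.coe_ne_top h
    rw [expError, ENNReal.toReal_sum fun ω _ =>
      ENNReal.mul_ne_top (R.P.apply_ne_top ω) ENNReal.ofReal_ne_top] at this
    simpa [ENNReal.toReal_mul, ENNReal.toReal_ofReal (norm_nonneg _)] using this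
  have h2 := Finset.sum_filter_add_sum_filter_not Finset.univ
    (fun ω => ‖g - R.output f ω‖ ≤ 4 * δ) fun ω => (R.P ω).toReal
  rw [sum_toReal_eq_one] at h2
  have h3 : (∑ ω with ¬ ‖g - R.output f ω‖ ≤ 4 * δ, (R.P ω).toReal * ‖g - R.output f ω‖) ≤ δ :=
    (Finset.sum_le_sum_of_subset_of_nonneg (Finset.filter_subset _ _)
      fun ω _ _ => by positivity).trans h1
  have h4 : (∑ ω with ¬ ‖g - R.output f ω‖ ≤ 4 * δ, (R.P ω).toReal) * (4 * δ) ≤ δ := by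
    rw [Finset.sum_mul]
    refine (Finset.sum_le_sum fun ω hω => ?_).trans h3
    have := (Finset.mem_filter.1 hω).2
    exact mul_le_mul_of_nonneg_left (by linarith) ENNReal.toReal_nonneg
  rcases δ.2.eq_or_lt with h0 | h0
  · -- For `δ = 0` the error vanishes almost surely.
    have h0' : (δ : ℝ) = 0 := h0.symm
    have h5 : ∀ ω ∈ Finset.univ.filter fun ω => ¬ ‖g - R.output f ω‖ ≤ 4 * δ,
        (R.P ω).toReal = 0 := by
      intro ω hω
      have hpos := (Finset.mem_filter.1 hω).2
      rw [h0', mul_zero, not_le] at hpos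
      have h6 := (Finset.sum_eq_zero_iff_of_nonneg fun ω _ => by positivity).1
        (le_antisymm (h0' ▸ h1) (Finset.sum_nonneg fun ω _ => by positivity)) ω (Finset.mem_univ ω)
      exact (mul_eq_zero.1 h6).resolve_right hpos.ne'
    rw [Finset.sum_eq_zero h5] at h2
    linarith
  · have h0' : (0 : ℝ) < δ := h0
    nlinarith

/-- The quantum error is at most four times the randomized error, provided that all inputs can be
rounded to finitely many values within the class, at an arbitrarily small change of the solution:
the rounding makes function values fit into finitely many qubits. -/
theorem eQuant_le_four_mul_eRan {n : ℕ} {D K G : Type*} [Nonempty D] [Nonempty K]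
    [NormedAddCommGroup G] {F : Set (D → K)} (S : F → G)
    (hround : ∀ ε : ℝ≥0, 0 < ε → ∃ r : K → K, (Set.range r).Finite ∧
      ∀ f : F, ∃ hf : r ∘ f.1 ∈ F, ‖S f - S ⟨r ∘ f.1, hf⟩‖ ≤ ε) :
    eQuant n S ≤ 4 * eRan n S := by
  rw [eRan, ENNReal.mul_iInf_of_ne (by norm_num) (by norm_num)]
  refine le_iInf fun R => ?_
  rcases eq_or_ne (⨆ f : F, R.expError f (S f)) ∞ with htop | htop
  · rw [htop, ENNReal.mul_top (by norm_num)]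
    exact le_top
  lift (⨆ f : F, R.expError f (S f)) to ℝ≥0 using htop with δ hδ
  have hcast : (4 : ℝ≥0∞) * δ = ((4 * δ : ℝ≥0) : ℝ≥0∞) := by push_cast; rfl
  rw [hcast]
  refine ENNReal.le_of_forall_pos_le_add fun ε hε _ => ?_
  obtain ⟨r, hr, hrF⟩ := hround ε hε
  obtain ⟨A, hA⟩ := exists_quantumAlgorithm_simulating R hr
  refine iInf₂_le_of_le n le_rfl (iInf_le_of_le A (iSup_le fun f => ?_))
  obtain ⟨hf, hfε⟩ := hrF f
  refine (iInf₂_le (4 * δ + ε) ?_).trans (by simp)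
  refine (R.three_quarters_le_prob (r ∘ f.1) (S ⟨_, hf⟩) δ ?_).trans
    ((Finset.sum_le_sum_of_subset_of_nonneg ?_ fun ω _ _ => ENNReal.toReal_nonneg).trans
      (hA f (S f) _))
  · rw [hδ]
    exact le_iSup (fun f : F => R.expError f (S f)) ⟨_, hf⟩
  · intro ω hω
    simp only [Finset.mem_filter, Finset.mem_univ, true_and] at hω ⊢
    calc ‖S f - R.output (r ∘ f.1) ω‖
        ≤ ‖S f - S ⟨_, hf⟩‖ + ‖S ⟨_, hf⟩ - R.output (r ∘ f.1) ω‖ :=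
          norm_sub_le_norm_sub_add_norm_sub _ _ _
      _ ≤ _ := by push_cast; linarith

/-! ### Coordinates of the normalized spaces -/

theorem LpSeq.norm_rpow {p : ℝ≥0∞} (hp : 1 ≤ p) (hp' : p ≠ ∞) {M : ℕ} {X : Type*}
    [NormedAddCommGroup X] (s : LpSeq p M X) :
    ‖s‖ ^ p.toReal = (1 / (M : ℝ)) * ∑ k : Fin M, ‖s k‖ ^ p.toReal := by
  have h0 : 0 < p.toReal := ENNReal.toReal_pos (zero_lt_one.trans_le hp).ne' hp'
  have hs : 0 ≤ (1 / (M : ℝ)) * ∑ k : Fin M, ‖s k‖ ^ p.toReal := by positivity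
  rw [LpSeq.norm_def, if_neg hp', ← Real.rpow_mul hs, one_div_mul_cancel h0.ne', Real.rpow_one]

theorem LpSeq.norm_apply_le {M : ℕ} {X : Type*} [NormedAddCommGroup X] (s : LpSeq ∞ M X)
    (k : Fin M) : ‖s k‖ ≤ ‖s‖ := by
  rw [LpSeq.norm_def, if_pos rfl]
  exact le_ciSup (f := fun k => ‖s k‖) (Set.finite_range _).bddAbove k

theorem LpSeq.norm_le_of_forall {M : ℕ} [NeZero M] {X : Type*} [NormedAddCommGroup X]
    (s : LpSeq ∞ M X) {c : ℝ} (h : ∀ k, ‖s k‖ ≤ c) : ‖s‖ ≤ c := by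
  rw [LpSeq.norm_def, if_pos rfl]
  exact ciSup_le h

/-- The `k`-th coordinate functional. -/
def LpSeq.coord {p : ℝ≥0∞} {M : ℕ} (k : Fin M) : LpSeq p M ℝ →ₗ[ℝ] ℝ :=
  LinearMap.proj (φ := fun _ : Fin M => ℝ) k

theorem LpSeq.coord_apply {p : ℝ≥0∞} {M : ℕ} (k : Fin M) (s : LpSeq p M ℝ) :
    LpSeq.coord k s = s k := rfl

instance {p : ℝ≥0∞} {M : ℕ} : FiniteDimensional ℝ (LpSeq p M ℝ) :=
  inferInstanceAs (FiniteDimensional ℝ (Fin M → ℝ))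

theorem mem_unitBall_top {N : ℕ} [NeZero N] {X : Type*} [NormedAddCommGroup X] {f : Fin N → X} :
    f ∈ unitBall ∞ N X ↔ ∀ i, ‖f i‖ ≤ 1 :=
  ⟨fun h i => (LpSeq.norm_apply_le (show LpSeq ∞ N X from f) i).trans h,
    fun h => LpSeq.norm_le_of_forall (show LpSeq ∞ N X from f) h⟩

section mean

variable {N : ℕ} [NeZero N] {X : Type*} [NormedAddCommGroup X] [NormedSpace ℝ X]

theorem norm_mean_le {g : Fin N → X} {c : ℝ} (h : ∀ i, ‖g i‖ ≤ c) :
    ‖(1 / (N : ℝ)) • ∑ i, g i‖ ≤ c := by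
  have hN : (0 : ℝ) < N := Nat.cast_pos.2 (NeZero.pos N)
  rw [norm_smul, Real.norm_of_nonneg (by positivity), one_div, inv_mul_le_iff₀ hN]
  simpa using norm_sum_le_of_le Finset.univ fun i _ => h i

/-- The elements of the unit ball of `L_∞^N(X)` can be rounded to finitely many values in the
unit ball of `X`, if `X` is finite-dimensional. -/
theorem exists_rounding [FiniteDimensional ℝ X] (ε : ℝ≥0) (hε : 0 < ε) :
    ∃ r : X → X, (Set.range r).Finite ∧ ∀ f : unitBall ∞ N X,
      ∃ hf : r ∘ f.1 ∈ unitBall ∞ N X, ‖meanMap N X f - meanMap N X ⟨r ∘ f.1, hf⟩‖ ≤ ε := by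
  classical
  have : ProperSpace X := FiniteDimensional.proper_real X
  obtain ⟨t, htB, ht, hcov⟩ := Metric.finite_approx_of_totallyBounded
    (isCompact_closedBall (0 : X) 1).totallyBounded ε hε
  have hnear : ∀ x : X, ‖x‖ ≤ 1 → ∃ y ∈ t, ‖x - y‖ < ε := fun x hx => by
    have := hcov (mem_closedBall_zero_iff.2 hx)
    simpa [dist_eq_norm] using this
  choose! r hrt hr using hnear
  let r' : X → X := fun x => if ‖x‖ ≤ 1 then r x else 0
  have hr' : ∀ x, ‖x‖ ≤ 1 → r' x = r x := fun x hx => if_pos hx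
  refine ⟨r', (ht.insert 0).subset ?_, fun f => ?_⟩
  · rintro _ ⟨x, rfl⟩
    by_cases hx : ‖x‖ ≤ 1
    · rw [hr' x hx]
      exact Set.mem_insert_of_mem _ (hrt x hx)
    · simp [r', hx]
  · have hf := mem_unitBall_top.1 f.2
    refine ⟨mem_unitBall_top.2 fun i => ?_, ?_⟩
    · rw [Function.comp_apply, hr' _ (hf i)]
      exact mem_closedBall_zero_iff.1 (htB (hrt _ (hf i)))
    · rw [meanMap, meanMap, ← smul_sub, ← Finset.sum_sub_distrib]
      refine norm_mean_le fun i => ?_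
      change ‖f.1 i - r' (f.1 i)‖ ≤ ε
      rw [hr' _ (hf i)]
      exact (hr _ (hf i)).le

/-! ### The Monte Carlo method -/

/-- The algorithm averaging the values at `n` independent uniformly distributed points. -/
def monteCarlo (n N : ℕ) [NeZero N] (X : Type*) [NormedAddCommGroup X] [NormedSpace ℝ X] :
    RandAlgorithm n (Fin N) X X where
  Ω := Fin n → Fin N
  P := PMF.uniformOfFintype _
  t ω := ω
  φ _ z := (1 / (n : ℝ)) • ∑ j, z j

open scoped BigOperators in
/-- The error of the Monte Carlo method is controlled by the mean norm of a sum of `n` independent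
centered vectors; the bound `2` comes from subtracting the mean from values in the unit ball. -/
theorem eRan_meanMap_le {n : ℕ} (hn : 1 ≤ n) {b : ℝ}
    (h : ∀ Y : Fin N → X, ∑ i, Y i = 0 → (∀ i, ‖Y i‖ ≤ 2) →
      (𝔼 ω : Fin n → Fin N, ‖∑ j, Y (ω j)‖) ≤ n * b) :
    eRan n (meanMap N X) ≤ ENNReal.ofReal b := by
  have hn' : (0 : ℝ) < n := Nat.cast_pos.2 hn
  have hN : (N : ℝ) ≠ 0 := Nat.cast_ne_zero.2 (NeZero.ne N)
  refine iInf_le_of_le (monteCarlo n N X) (iSup_le fun f => ?_)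
  have hf := mem_unitBall_top.1 f.2
  have hm : ‖meanMap N X f‖ ≤ 1 := norm_mean_le hf
  have hsum : ∑ i, (f.1 i - meanMap N X f) = 0 := by
    rw [Finset.sum_sub_distrib, Finset.sum_const, Finset.card_univ, Fintype.card_fin, meanMap,
      ← Nat.cast_smul_eq_nsmul ℝ, smul_smul, mul_one_div_cancel hN, one_smul, sub_self]
  have herr : ∀ ω : Fin n → Fin N, ‖meanMap N X f - (monteCarlo n N X).output f.1 ω‖
      = (n : ℝ)⁻¹ * ‖∑ j, (f.1 (ω j) - meanMap N X f)‖ := by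
    intro ω
    have : meanMap N X f - (monteCarlo n N X).output f.1 ω
        = -((n : ℝ)⁻¹ • ∑ j, (f.1 (ω j) - meanMap N X f)) := by
      rw [Finset.sum_sub_distrib, Finset.sum_const, Finset.card_univ, Fintype.card_fin,
        ← Nat.cast_smul_eq_nsmul ℝ, smul_sub, smul_smul, inv_mul_cancel₀ hn'.ne', one_smul, neg_sub,
        ← one_div]
      rfl
    rw [this, norm_neg, norm_smul, Real.norm_of_nonneg (by positivity)]
  have hE := h _ hsum fun i => (norm_sub_le _ _).trans (by linarith [hf i])
  have hexp : (monteCarlo n N X).expError f.1 (meanMap N X f) =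
      ENNReal.ofReal ((n : ℝ)⁻¹ * 𝔼 ω : Fin n → Fin N, ‖∑ j, (f.1 (ω j) - meanMap N X f)‖) := by
    rw [Fintype.expect_eq_sum_div_card, mul_div_assoc', Finset.mul_sum, Finset.sum_div,
      ENNReal.ofReal_sum_of_nonneg fun ω _ => by positivity]
    refine Fintype.sum_congr _ _ fun ω : Fin n → Fin N => ?_
    rw [herr ω, div_eq_inv_mul, ENNReal.ofReal_mul (by positivity),
      ENNReal.ofReal_mul (p := (Fintype.card (Fin n → Fin N) : ℝ)⁻¹) (by positivity),
      ENNReal.ofReal_mul (by positivity)]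
    congr 1
    change PMF.uniformOfFintype (Fin n → Fin N) ω = _
    rw [PMF.uniformOfFintype_apply, ENNReal.ofReal_inv_of_pos (by positivity),
      ENNReal.ofReal_natCast]
  rw [hexp]
  refine ENNReal.ofReal_le_ofReal ?_
  rwa [inv_mul_le_iff₀ hn']

end mean

/-! ### Potential functions for sums of independent centered vectors -/

open scoped BigOperators in
/-- If the potential `Φ` grows, in one step, by a factor `A`, a constant `B` and a term that is
linear in the step, then the linear term averages out for centered steps, and the mean potential
grows by `A` and `B` only. -/
theorem expect_potential_le {ι X : Type*} [Fintype ι] [Nonempty ι] [AddCommGroup X] [Module ℝ X]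
    {Y : ι → X} (hY : ∑ i, Y i = 0) (Φ : X → ℝ) (L : X → X →ₗ[ℝ] ℝ) {A B : ℝ} (hA : 1 ≤ A)
    (hB : 0 ≤ B) (h : ∀ s i, Φ (s + Y i) ≤ A * Φ s + L s (Y i) + B) (n : ℕ) :
    (𝔼 ω : Fin n → ι, Φ (∑ j, Y (ω j))) ≤ A ^ n * (Φ 0 + n * B) := by
  induction n with
  | zero => simp
  | succ n ih =>
    have hstep : ∀ s, (𝔼 i, Φ (s + Y i)) ≤ A * Φ s + B := fun s => by
      calc (𝔼 i, Φ (s + Y i)) ≤ 𝔼 i, (A * Φ s + L s (Y i) + B) :=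
            Finset.expect_le_expect fun i _ => h s i
        _ = A * Φ s + B := by
            have : (𝔼 i, L s (Y i)) = 0 := by
              rw [Fintype.expect_eq_sum_div_card, ← map_sum, hY, map_zero, zero_div]
            rw [Finset.expect_add_distrib, Finset.expect_add_distrib, this, Fintype.expect_const,
              Fintype.expect_const, add_zero]
    calc (𝔼 ω : Fin (n + 1) → ι, Φ (∑ j, Y (ω j)))
        = 𝔼 q : ι × (Fin n → ι), Φ ((∑ j, Y (q.2 j)) + Y q.1) :=
          (Fintype.expect_equiv (Fin.consEquiv fun _ : Fin (n + 1) => ι) _ _ fun q => by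
            rw [Fin.sum_univ_succ, add_comm]; simp [Fin.consEquiv]).symm
      _ = 𝔼 ω : Fin n → ι, 𝔼 i, Φ ((∑ j, Y (ω j)) + Y i) := by
          rw [← Finset.univ_product_univ, Finset.expect_product, Finset.expect_comm]
      _ ≤ 𝔼 ω : Fin n → ι, (A * Φ (∑ j, Y (ω j)) + B) :=
          Finset.expect_le_expect fun ω _ => hstep _
      _ = A * (𝔼 ω : Fin n → ι, Φ (∑ j, Y (ω j))) + B := by
          rw [Finset.expect_add_distrib, Fintype.expect_const, Finset.mul_expect]
      _ ≤ A * (A ^ n * (Φ 0 + n * B)) + A ^ (n + 1) * B :=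
          add_le_add (mul_le_mul_of_nonneg_left ih (by linarith))
            (le_mul_of_one_le_left hB (one_le_pow₀ hA))
      _ = A ^ (n + 1) * (Φ 0 + (n + 1 : ℕ) * B) := by push_cast; ring

/-! ### Finite exponents -/

/-- A first-order expansion of `|·| ^ p` at `1`. The quadratic part of the remainder is traded for
`1 / lam`, so that with `lam = n` the expansion can be iterated `n` times at bounded cost. -/
theorem abs_one_add_rpow_le {p lam : ℝ} (hp : 1 ≤ p) (hl : 1 ≤ lam) (t : ℝ) :
    |1 + t| ^ p ≤
      1 + p * t + 1 / lam + 2 * (p + 1) ^ p * lam ^ max (p / 2 - 1) 0 * |t| ^ p := by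
  have hp0 : 0 < p := by linarith
  have hlr : 1 ≤ lam ^ max (p / 2 - 1) 0 := Real.one_le_rpow hl (le_max_right _ _)
  have hpp : p ^ p ≤ (p + 1) ^ p := Real.rpow_le_rpow hp0.le (by linarith) hp0.le
  have hmul : (p * |t|) ^ p = p ^ p * |t| ^ p := Real.mul_rpow hp0.le (abs_nonneg t)
  have hT : 0 ≤ |t| ^ p := by positivity
  have hC : 0 ≤ (p + 1) ^ p := by positivity
  have hl0 : 0 < 1 / lam := by positivity
  rcases le_or_gt (p * |t|) 1 with h | h
  · have habs : |p * t| ≤ 1 := by rwa [abs_mul, abs_of_pos hp0]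
    have ht1 : |t| ≤ 1 := by nlinarith [abs_nonneg t]
    have h1t : 0 ≤ 1 + t := by linarith [neg_le_of_abs_le ht1]
    have hexp : |1 + t| ^ p ≤ 1 + p * t + (p * t) ^ 2 := by
      have h1 : (1 + t) ^ p ≤ Real.exp (p * t) := by
        rw [mul_comm p t, Real.exp_mul]
        exact Real.rpow_le_rpow h1t (by linarith [Real.add_one_le_exp t]) hp0.le
      have h2 := (abs_le.1 (Real.abs_exp_sub_one_sub_id_le habs)).2
      rw [abs_of_nonneg h1t]
      linarith
    -- The quadratic term is either at most `1 / lam`, or dominated by the power of order `p`.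
    have hu : (p * |t|) ^ 2 ≤ 1 / lam + lam ^ max (p / 2 - 1) 0 * (p * |t|) ^ p := by
      have hu0 : 0 ≤ p * |t| := by positivity
      generalize p * |t| = u at h hu0
      rcases le_or_gt (u ^ 2) (1 / lam) with hs | hs
      · have : 0 ≤ lam ^ max (p / 2 - 1) 0 * u ^ p := by positivity
        linarith
      · have hupos : 0 < u := by
          rcases hu0.eq_or_lt with h0 | h0
          · rw [← h0] at hs
            norm_num at hs
            linarith
          · exact h0
        have hlu : 1 ≤ lam * u ^ 2 := by
          rw [div_lt_iff₀ (by linarith)] at hs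
          linarith
        have hkey : u ^ 2 ≤ lam ^ max (p / 2 - 1) 0 * u ^ p := by
          rcases le_total p 2 with h2 | h2
          · have : u ^ 2 ≤ u ^ p := by
              rw [← Real.rpow_natCast]
              exact Real.rpow_le_rpow_of_exponent_ge hupos h (by simpa using h2)
            nlinarith
          · have hmax : max (p / 2 - 1) 0 = p / 2 - 1 := max_eq_left (by linarith)
            have h3 : 1 ≤ (lam * u ^ 2) ^ (p / 2 - 1) := Real.one_le_rpow hlu (by linarith)
            have h4 : u ^ p = u ^ 2 * (u ^ 2) ^ (p / 2 - 1) := by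
              rw [← Real.rpow_natCast, ← Real.rpow_mul hu0, ← Real.rpow_add hupos]
              congr 1
              push_cast
              ring
            rw [Real.mul_rpow (by linarith) (by positivity)] at h3
            rw [hmax, h4]
            nlinarith [sq_nonneg u]
        linarith
    have hsq : (p * t) ^ 2 = (p * |t|) ^ 2 := by rw [mul_pow, mul_pow, sq_abs]
    rw [hmul] at hu
    have : lam ^ max (p / 2 - 1) 0 * (p ^ p * |t| ^ p) ≤
        2 * (p + 1) ^ p * lam ^ max (p / 2 - 1) 0 * |t| ^ p := by
      have h5 : 0 ≤ lam ^ max (p / 2 - 1) 0 * |t| ^ p := by positivity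
      nlinarith
    linarith
  · have h1 : |1 + t| ≤ (p + 1) * |t| := by
      have := abs_add_le 1 t
      rw [abs_one] at this
      linarith
    have h2 : |1 + t| ^ p ≤ (p + 1) ^ p * |t| ^ p := by
      rw [← Real.mul_rpow (by linarith) (abs_nonneg t)]
      exact Real.rpow_le_rpow (abs_nonneg _) h1 hp0.le
    have h3 : -(p * t) ≤ p ^ p * |t| ^ p := by
      rw [← hmul]
      calc -(p * t) ≤ p * |t| := by nlinarith [neg_abs_le t]
        _ = (p * |t|) ^ (1 : ℝ) := (Real.rpow_one _).symm
        _ ≤ _ := Real.rpow_le_rpow_of_exponent_le h.le hp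
    have h4 : 2 * ((p + 1) ^ p * |t| ^ p) ≤
        2 * (p + 1) ^ p * lam ^ max (p / 2 - 1) 0 * |t| ^ p := by
      have h5 : 0 ≤ (p + 1) ^ p * |t| ^ p := by positivity
      nlinarith
    nlinarith

theorem abs_add_rpow_le {p lam : ℝ} (hp : 1 ≤ p) (hl : 1 ≤ lam) (s y : ℝ) :
    |s + y| ^ p ≤ (1 + 1 / lam) * |s| ^ p + p * |s| ^ p * s⁻¹ * y +
      2 * (p + 1) ^ p * lam ^ max (p / 2 - 1) 0 * |y| ^ p := by
  have hp0 : 0 < p := by linarith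
  rcases eq_or_ne s 0 with rfl | hs
  · have hlr : 1 ≤ lam ^ max (p / 2 - 1) 0 := Real.one_le_rpow hl (le_max_right _ _)
    have hpp : 1 ≤ (p + 1) ^ p := Real.one_le_rpow (by linarith) hp0.le
    have hC : 1 ≤ 2 * (p + 1) ^ p * lam ^ max (p / 2 - 1) 0 := by nlinarith
    have hy : 0 ≤ |y| ^ p := by positivity
    simp only [zero_add, abs_zero, Real.zero_rpow hp0.ne', mul_zero, inv_zero, zero_mul]
    nlinarith
  · have h := mul_le_mul_of_nonneg_left (abs_one_add_rpow_le hp hl (y / s))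
      (Real.rpow_nonneg (abs_nonneg s) p)
    have h1 : |s| ^ p * |1 + y / s| ^ p = |s + y| ^ p := by
      rw [← Real.mul_rpow (abs_nonneg _) (abs_nonneg _), ← abs_mul, mul_add, mul_one,
        mul_div_cancel₀ _ hs]
    have h2 : |s| ^ p * |y / s| ^ p = |y| ^ p := by
      rw [← Real.mul_rpow (abs_nonneg _) (abs_nonneg _), ← abs_mul, mul_div_cancel₀ _ hs]
    rw [h1] at h
    refine h.trans (le_of_eq ?_)
    rw [← h2]
    ring

open scoped BigOperators in
/-- For `p < ∞`, the sum of `n` independent centered bounded vectors in `L_p^M` has mean norm of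
order `n ^ max (1/2) (1/p)`, uniformly in `M`: `L_p` has type `min p 2`. The potential is the
`p`-th power of the norm. -/
theorem expect_norm_sum_le {p : ℝ≥0∞} [hp : Fact (1 ≤ p)] (hp' : p ≠ ∞) {n M N : ℕ} [NeZero N]
    (hn : 1 ≤ n) {Y : Fin N → LpSeq p M ℝ} (hY : ∑ i, Y i = 0) (hY2 : ∀ i, ‖Y i‖ ≤ 2) :
    (𝔼 ω : Fin n → Fin N, ‖∑ j, Y (ω j)‖) ≤
      (Real.exp 1 * (2 * (p.toReal + 1) ^ p.toReal * 2 ^ p.toReal)) ^ (1 / p.toReal) *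
        (n : ℝ) ^ max (1 / 2) (1 / p.toReal) := by
  have hq : 1 ≤ p.toReal := by
    rw [← ENNReal.toReal_one]
    exact ENNReal.toReal_mono hp' hp.out
  have hnorm := fun s : LpSeq p M ℝ => LpSeq.norm_rpow hp.out hp' s
  generalize p.toReal = q at hq hnorm
  have hq0 : 0 < q := by linarith
  have hn1 : (1 : ℝ) ≤ n := by exact_mod_cast hn
  have hn0 : (0 : ℝ) < n := by linarith
  set C : ℝ := 2 * (q + 1) ^ q
  have hC : 0 ≤ C := by positivity
  set r : ℝ := max (q / 2 - 1) 0
  let L (s : LpSeq p M ℝ) : LpSeq p M ℝ →ₗ[ℝ] ℝ :=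
    (1 / (M : ℝ)) • ∑ k, (q * |s k| ^ q * (s k)⁻¹) • LpSeq.coord k
  have hL : ∀ s y, L s y = (1 / (M : ℝ)) * ∑ k, q * |s k| ^ q * (s k)⁻¹ * y k := by
    intro s y
    simp [L, LpSeq.coord_apply]
  have hstep : ∀ s i, ‖s + Y i‖ ^ q ≤
      (1 + 1 / (n : ℝ)) * ‖s‖ ^ q + L s (Y i) + C * (n : ℝ) ^ r * 2 ^ q := by
    intro s i
    calc ‖s + Y i‖ ^ q = (1 / (M : ℝ)) * ∑ k, |s k + Y i k| ^ q := hnorm _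
      _ ≤ (1 / (M : ℝ)) * ∑ k, ((1 + 1 / (n : ℝ)) * |s k| ^ q + q * |s k| ^ q * (s k)⁻¹ * Y i k +
            C * (n : ℝ) ^ r * |Y i k| ^ q) :=
          mul_le_mul_of_nonneg_left
            (Finset.sum_le_sum fun k _ => abs_add_rpow_le hq hn1 (s k) (Y i k)) (by positivity)
      _ = (1 + 1 / (n : ℝ)) * ‖s‖ ^ q + L s (Y i) + C * (n : ℝ) ^ r * ‖Y i‖ ^ q := by
          rw [hnorm, hnorm, hL, Finset.sum_add_distrib, Finset.sum_add_distrib,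
            ← Finset.mul_sum, ← Finset.mul_sum]
          simp only [Real.norm_eq_abs]
          ring
      _ ≤ _ := by
          gcongr
          exact hY2 i
  have hpot := expect_potential_le hY (fun s => ‖s‖ ^ q) L (A := 1 + 1 / (n : ℝ))
    (by linarith [show 0 < 1 / (n : ℝ) by positivity]) (by positivity) hstep n
  have hA : (1 + 1 / (n : ℝ)) ^ n ≤ Real.exp 1 := by
    calc (1 + 1 / (n : ℝ)) ^ n ≤ Real.exp (1 / (n : ℝ)) ^ n := by
          gcongr
          linarith [Real.add_one_le_exp (1 / (n : ℝ))]
      _ = Real.exp 1 := by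
          rw [← Real.exp_nat_mul, mul_one_div_cancel hn0.ne']
  have hbound : (𝔼 ω : Fin n → Fin N, ‖∑ j, Y (ω j)‖ ^ q) ≤
      Real.exp 1 * (C * 2 ^ q) * (n : ℝ) ^ (1 + r) := by
    refine hpot.trans ?_
    rw [norm_zero, Real.zero_rpow hq0.ne', zero_add, Real.rpow_add hn0, Real.rpow_one]
    calc _ ≤ Real.exp 1 * (n * (C * (n : ℝ) ^ r * 2 ^ q)) := by gcongr
      _ = _ := by ring
  have hjensen : (𝔼 ω : Fin n → Fin N, ‖∑ j, Y (ω j)‖) ≤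
      (𝔼 ω : Fin n → Fin N, ‖∑ j, Y (ω j)‖ ^ q) ^ (1 / q) := by
    have := Real.arith_mean_le_rpow_mean Finset.univ
      (fun _ : Fin n → Fin N => (Fintype.card (Fin n → Fin N) : ℝ)⁻¹)
      (fun ω => ‖∑ j, Y (ω j)‖) (fun _ _ => by positivity) (by simp)
      (fun _ _ => norm_nonneg _) hq
    rw [← Finset.mul_sum, ← Finset.mul_sum, ← div_eq_inv_mul, ← div_eq_inv_mul] at this
    rwa [Fintype.expect_eq_sum_div_card, Fintype.expect_eq_sum_div_card]
  have hr : (1 + r) * (1 / q) = max (1 / 2) (1 / q) := by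
    have : 1 + r = max (q / 2) 1 := by
      simp only [r]
      rw [← max_add_add_left]
      congr 1 <;> ring
    rw [this, max_mul_of_nonneg _ _ (by positivity)]
    congr 1
    · field_simp
    · ring
  refine hjensen.trans ((Real.rpow_le_rpow (Finset.expect_nonneg fun ω _ => by positivity)
    hbound (by positivity)).trans (le_of_eq ?_))
  rw [Real.mul_rpow (by positivity) (by positivity), ← Real.rpow_mul hn0.le, hr]

/-! ### The exponent infinity -/

theorem exp_le_add_exp_sq (u : ℝ) : Real.exp u ≤ u + Real.exp (u ^ 2) := by
  have h := Real.add_one_le_exp (u ^ 2)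
  rcases le_or_gt |u| 1 with h1 | h1
  · linarith [(abs_le.1 (Real.abs_exp_sub_one_sub_id_le h1)).2]
  · rcases lt_abs.1 h1 with h2 | h2
    · have := Real.exp_le_exp.2 (show u ≤ u ^ 2 by nlinarith)
      linarith
    · have := Real.exp_le_one_iff.2 (show u ≤ 0 by linarith)
      nlinarith

open scoped BigOperators in
/-- An exponential moment bound with a free parameter `θ`; the potential is the sum of
`exp (± θ s k)` over the coordinates `k`. -/
theorem expect_norm_sum_top_le_of_pos {n M N : ℕ} [NeZero N] [NeZero M] {Y : Fin N → LpSeq ∞ M ℝ}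
    (hY : ∑ i, Y i = 0) (hY2 : ∀ i, ‖Y i‖ ≤ 2) {θ : ℝ} (hθ : 0 < θ) :
    θ * (𝔼 ω : Fin n → Fin N, ‖∑ j, Y (ω j)‖) ≤ Real.log (2 * M) + n * (4 * θ ^ 2) := by
  have hM : (0 : ℝ) < M := Nat.cast_pos.2 (NeZero.pos M)
  let Φ (s : LpSeq ∞ M ℝ) : ℝ := ∑ k, (Real.exp (θ * s k) + Real.exp (-(θ * s k)))
  let L (s : LpSeq ∞ M ℝ) : LpSeq ∞ M ℝ →ₗ[ℝ] ℝ :=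
    ∑ k, (θ * (Real.exp (θ * s k) - Real.exp (-(θ * s k)))) • LpSeq.coord k
  have hstep : ∀ s i, Φ (s + Y i) ≤ Real.exp (4 * θ ^ 2) * Φ s + L s (Y i) + 0 := by
    intro s i
    simp only [Φ, L, LinearMap.sum_apply, LinearMap.smul_apply, LpSeq.coord_apply, smul_eq_mul]
    rw [Finset.mul_sum, ← Finset.sum_add_distrib, add_zero]
    refine Finset.sum_le_sum fun k _ => ?_
    have hk : |Y i k| ≤ 2 := (LpSeq.norm_apply_le (Y i) k).trans (hY2 i)
    have hexp : Real.exp ((θ * Y i k) ^ 2) ≤ Real.exp (4 * θ ^ 2) := by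
      refine Real.exp_le_exp.2 ?_
      have : (Y i k) ^ 2 ≤ 4 := by
        rw [← sq_abs]
        nlinarith [abs_nonneg (Y i k)]
      rw [mul_pow]
      nlinarith [sq_nonneg θ]
    have h1 := exp_le_add_exp_sq (θ * Y i k)
    have h2 := exp_le_add_exp_sq (-(θ * Y i k))
    rw [neg_sq] at h2
    have e1 : Real.exp (θ * (s + Y i) k) = Real.exp (θ * s k) * Real.exp (θ * Y i k) := by
      rw [← Real.exp_add, ← mul_add]
      rfl
    have e2 : Real.exp (-(θ * (s + Y i) k)) =
        Real.exp (-(θ * s k)) * Real.exp (-(θ * Y i k)) := by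
      rw [← Real.exp_add, ← neg_add, ← mul_add]
      rfl
    rw [e1, e2]
    have h3 := mul_le_mul_of_nonneg_left (h1.trans (add_le_add_right hexp _))
      (Real.exp_pos (θ * s k)).le
    have h4 := mul_le_mul_of_nonneg_left (h2.trans (add_le_add_right hexp _))
      (Real.exp_pos (-(θ * s k))).le
    linarith
  have hpot := expect_potential_le hY Φ L (Real.one_le_exp (by positivity)) le_rfl hstep n
  have hΦ0 : Φ 0 = 2 * M := by
    have : ∀ k, (0 : LpSeq ∞ M ℝ) k = 0 := fun k => rfl
    simp only [Φ, this]
    simp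
    ring
  rw [hΦ0, mul_zero, add_zero] at hpot
  have hlow : ∀ s : LpSeq ∞ M ℝ, Real.exp (θ * ‖s‖) ≤ Φ s := by
    intro s
    have hpos : ∀ k, 0 ≤ Real.exp (θ * s k) + Real.exp (-(θ * s k)) := fun k => by positivity
    have hΦ : 0 < Φ s := Finset.sum_pos (fun k _ => by positivity) Finset.univ_nonempty
    rw [← Real.le_log_iff_exp_le hΦ, ← le_div_iff₀' hθ]
    refine LpSeq.norm_le_of_forall s fun k => ?_
    rw [le_div_iff₀' hθ, Real.le_log_iff_exp_le hΦ]
    refine le_trans ?_ (Finset.single_le_sum (fun k _ => hpos k) (Finset.mem_univ k))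
    rw [Real.norm_eq_abs, ← abs_of_pos hθ, ← abs_mul, abs_of_pos hθ]
    rcases abs_choice (θ * s k) with h | h <;> rw [h] <;>
      linarith [Real.exp_pos (θ * s k), Real.exp_pos (-(θ * s k))]
  set T : ℝ := Real.log (2 * M) + n * (4 * θ ^ 2)
  have hT : Real.exp T = Real.exp (4 * θ ^ 2) ^ n * (2 * M) := by
    rw [Real.exp_add, Real.exp_log (by positivity), Real.exp_nat_mul, mul_comm]
  -- The tangent to the exponential function at `T` replaces Jensen's inequality.
  have htan : ∀ s : LpSeq ∞ M ℝ, θ * ‖s‖ ≤ Real.exp (-T) * Φ s + (T - 1) := by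
    intro s
    have h1 := Real.add_one_le_exp (θ * ‖s‖ - T)
    have h2 := mul_le_mul_of_nonneg_left (hlow s) (Real.exp_pos (-T)).le
    rw [← Real.exp_add, show -T + θ * ‖s‖ = θ * ‖s‖ - T by ring] at h2
    linarith
  calc θ * (𝔼 ω : Fin n → Fin N, ‖∑ j, Y (ω j)‖)
      = 𝔼 ω : Fin n → Fin N, θ * ‖∑ j, Y (ω j)‖ := Finset.mul_expect _ _ _
    _ ≤ 𝔼 ω : Fin n → Fin N, (Real.exp (-T) * Φ (∑ j, Y (ω j)) + (T - 1)) :=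
        Finset.expect_le_expect fun ω _ => htan _
    _ = Real.exp (-T) * (𝔼 ω : Fin n → Fin N, Φ (∑ j, Y (ω j))) + (T - 1) := by
        rw [Finset.expect_add_distrib, Fintype.expect_const, Finset.mul_expect]
    _ ≤ Real.exp (-T) * Real.exp T + (T - 1) := by
        rw [hT]
        gcongr
    _ = T := by rw [← Real.exp_add]; simp

open scoped BigOperators in
theorem expect_norm_sum_top_le {n M N : ℕ} [NeZero N] [NeZero M] (hn : 1 ≤ n)
    {Y : Fin N → LpSeq ∞ M ℝ} (hY : ∑ i, Y i = 0) (hY2 : ∀ i, ‖Y i‖ ≤ 2) :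
    (𝔼 ω : Fin n → Fin N, ‖∑ j, Y (ω j)‖) ≤ 6 * (√n * √(Real.logb 2 (M + 1))) := by
  have hM : (1 : ℝ) ≤ M := by exact_mod_cast NeZero.one_le
  have hn0 : (0 : ℝ) < √n := Real.sqrt_pos.2 (Nat.cast_pos.2 hn)
  have hlog : Real.log (2 * M) ≤ 2 * Real.logb 2 (M + 1) := by
    have h1 : Real.log (2 * M) ≤ 2 * Real.log (M + 1) := by
      have : 2 * Real.log ((M : ℝ) + 1) = Real.log (((M : ℝ) + 1) ^ 2) := by
        rw [Real.log_pow]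
        norm_num
      rw [this]
      exact Real.log_le_log (by positivity) (by nlinarith)
    have h2 : Real.log ((M : ℝ) + 1) ≤ Real.logb 2 (M + 1) := by
      rw [Real.logb]
      exact le_div_self (Real.log_nonneg (by linarith)) (Real.log_pos (by norm_num))
        (by linarith [Real.log_two_lt_d9])
    linarith
  have hL : 0 < Real.logb 2 (M + 1) := Real.logb_pos (by norm_num) (by linarith)
  have ha : 0 < √(Real.logb 2 (M + 1)) := Real.sqrt_pos.2 hL
  -- This `θ` balances the two terms of the exponential moment bound.
  have h := expect_norm_sum_top_le_of_pos (n := n) hY hY2 (div_pos ha hn0)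
  rw [← Real.sq_sqrt hL.le] at hlog
  have hsq : (n : ℝ) = √n ^ 2 := (Real.sq_sqrt (Nat.cast_nonneg n)).symm
  generalize √(Real.logb 2 ((M : ℝ) + 1)) = a at *
  rw [div_mul_eq_mul_div, div_le_iff₀ hn0] at h
  have h3 : (n : ℝ) * (4 * (a / √n) ^ 2) = 4 * a ^ 2 := by
    rw [div_pow, ← hsq]
    field_simp
  rw [h3] at h
  refine le_of_mul_le_mul_left (h.trans ?_) ha
  nlinarith

end VecMean

end

theorem corollary3 (p : ℝ≥0∞) [Fact (1 ≤ p)] :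
    ∃ c : ℝ, 0 < c ∧ ∀ n M N : ℕ, 1 ≤ n → 1 ≤ M → 1 ≤ N →
      VecMean.eQuant n (VecMean.meanMap N (VecMean.LpSeq p M ℝ)) ≤
        4 * VecMean.eRan n (VecMean.meanMap N (VecMean.LpSeq p M ℝ)) ∧
      (2 ≤ p → p < ∞ →
        4 * VecMean.eRan n (VecMean.meanMap N (VecMean.LpSeq p M ℝ)) ≤
          ENNReal.ofReal (c * (n : ℝ) ^ (-(1 / 2) : ℝ))) ∧
      (p = ∞ →
        4 * VecMean.eRan n (VecMean.meanMap N (VecMean.LpSeq p M ℝ)) ≤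
          ENNReal.ofReal
            (c * (n : ℝ) ^ (-(1 / 2) : ℝ) * (Real.logb 2 ((M : ℝ) + 1)) ^ (1 / 2 : ℝ))) ∧
      (p < 2 →
        4 * VecMean.eRan n (VecMean.meanMap N (VecMean.LpSeq p M ℝ)) ≤
          ENNReal.ofReal (c * (n : ℝ) ^ (-1 + 1 / p.toReal))) := by
  have hquant : ∀ n M N : ℕ, 1 ≤ N → VecMean.eQuant n (VecMean.meanMap N (VecMean.LpSeq p M ℝ)) ≤
      4 * VecMean.eRan n (VecMean.meanMap N (VecMean.LpSeq p M ℝ)) := by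
    intro n M N hN
    have : NeZero N := ⟨by omega⟩
    exact VecMean.eQuant_le_four_mul_eRan _ fun ε hε => VecMean.exists_rounding ε hε
  have h4 : ∀ (x : ℝ≥0∞) (b : ℝ), x ≤ ENNReal.ofReal b → 4 * x ≤ ENNReal.ofReal (4 * b) := by
    intro x b h
    rw [ENNReal.ofReal_mul (by norm_num)]
    gcongr
    simp
  rcases eq_or_ne p ∞ with rfl | hp
  · refine ⟨24, by norm_num, fun n M N hn hM hN =>
      ⟨hquant n M N hN, fun _ h => (lt_irrefl _ h).elim, fun _ => ?_, fun h => (not_top_lt h).elim⟩⟩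
    have : NeZero N := ⟨by omega⟩
    have : NeZero M := ⟨by omega⟩
    have hn0 : (0 : ℝ) < n := Nat.cast_pos.2 hn
    have hb := h4 _ (6 * ((n : ℝ) ^ (-(1 / 2) : ℝ) * √(Real.logb 2 (M + 1))))
      (VecMean.eRan_meanMap_le (N := N) (X := VecMean.LpSeq _ M ℝ) hn fun Y hY hY2 =>
        (VecMean.expect_norm_sum_top_le hn hY hY2).trans (le_of_eq (by
          have : √(n : ℝ) = n * (n : ℝ) ^ (-(1 / 2) : ℝ) := by
            rw [Real.sqrt_eq_rpow, ← Real.rpow_one_add' hn0.le (by norm_num)]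
            norm_num
          rw [this]
          ring)))
    rw [← Real.sqrt_eq_rpow]
    refine hb.trans (le_of_eq ?_)
    congr 1
    ring
  · set q := p.toReal with hq
    set c : ℝ := (Real.exp 1 * (2 * (q + 1) ^ q * 2 ^ q)) ^ (1 / q)
    have hq0 : 0 ≤ q := ENNReal.toReal_nonneg
    have hc : 0 < c := by positivity
    have hran : ∀ n M N : ℕ, 1 ≤ n → 1 ≤ N →
        4 * VecMean.eRan n (VecMean.meanMap N (VecMean.LpSeq p M ℝ)) ≤
          ENNReal.ofReal (4 * c * (n : ℝ) ^ (-1 + max (1 / 2) (1 / q))) := by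
      intro n M N hn hN
      have : NeZero N := ⟨by omega⟩
      have hn0 : (0 : ℝ) < n := Nat.cast_pos.2 hn
      have hb := h4 _ (c * (n : ℝ) ^ (-1 + max (1 / 2) (1 / q)))
        (VecMean.eRan_meanMap_le (N := N) (X := VecMean.LpSeq _ M ℝ) hn fun Y hY hY2 =>
          (VecMean.expect_norm_sum_le (M := M) hp hn hY hY2).trans (le_of_eq (by
            rw [Real.rpow_add hn0, Real.rpow_neg_one, mul_left_comm (n : ℝ),
              mul_inv_cancel_left₀ hn0.ne'])))
      rwa [← mul_assoc] at hb
    refine ⟨4 * c, by positivity, fun n M N hn hM hN =>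
      ⟨hquant n M N hN, fun h2 _ => ?_, fun h => (hp h).elim, fun h2 => ?_⟩⟩
    · have hq2 : 2 ≤ q := by
        have := ENNReal.toReal_mono hp h2
        simpa using this
      have hmax : -1 + max (1 / 2) (1 / q) = -(1 / 2) := by
        rw [max_eq_left (one_div_le_one_div_of_le (by norm_num) hq2)]
        norm_num
      rw [← hmax]
      exact hran n M N hn hN
    · have hq1 : 1 ≤ q := by
        have := ENNReal.toReal_mono hp (Fact.out : 1 ≤ p)
        simpa using this
      have hq2 : q ≤ 2 := by
        have := ENNReal.toReal_mono (by norm_num) h2.le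
        simpa using this
      rw [← max_eq_right (one_div_le_one_div_of_le (by linarith) hq2)]
      exact hran n M N hn hN
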